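/- Let $P\subset\mathbb R^n$ be a simple $n$-dimensional convex polytope (every vertex lies in exactly $n$ facets) with set of facets $\{F_1,\dots,F_m\}$, and let $\mathbb T^r=\mathbb R^r/\mathbb Z^r$. Let $\Lambda\colon\{F_1,\dots,F_m\}\to\mathbb Z^r\setminus\{\boldsymbol 0\}$, $F_i\mapsto\Lambda_i$, be a map such that $\Lambda_1,\dots,\Lambda_m$ span $\mathbb Z^r$ and such that for every vertex $v=F_{i_1}\cap\dots\cap F_{i_n}$ of $P$ the distinct vectors among $\Lambda_{i_1},\dots,\Lambda_{i_n}$ form a part of a basis of $\mathbb Z^r$. Let $$M(P,\Lambda)=P\times\mathbb T^r/\sim$$ with the quotient topology, where $(p_1,t_1)\sim(p_2,t_2)$ if and only if $p_1=p_2$ and $t_1-t_2\in\bigl\{\sum_{i\colon p_1\in F_i}\Lambda_i\varphi_i:\varphi_i\in\mathbb R/\mathbb Z\bigr\}$. Then $M(P,\Lambda)$ is a closed topological $(n+r)$-manifold, that is, a compact Hausdorff second countable space in which every point has an open neighbourhood homeomorphic to an open subset of $\mathbb R^{n+r}$. -/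

import Mathlib

/-- `P` is an `n`-dimensional convex polytope in `ℝⁿ`: a bounded intersection of finitely many
closed half-spaces whose affine hull is all of `ℝⁿ`. -/
structure IsPolytope {n : ℕ} (P : Set (EuclideanSpace ℝ (Fin n))) : Prop where
  exists_halfSpaces : ∃ (k : ℕ) (a : Fin k → EuclideanSpace ℝ (Fin n)) (b : Fin k → ℝ),
    P = {x | ∀ i, inner ℝ (a i) x ≤ b i}
  isBounded : Bornology.IsBounded P
  affineSpan_eq_top : affineSpan ℝ P = ⊤

/-- A facet of a subset `P` of `ℝⁿ`: a nonempty face (exposed subset) of dimension `n - 1`. -/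
structure IsFacet {n : ℕ} (P F : Set (EuclideanSpace ℝ (Fin n))) : Prop where
  nonempty : F.Nonempty
  isExposed : IsExposed ℝ P F
  finrank_add_one : Module.finrank ℝ (vectorSpan ℝ F) + 1 = n

/-- The type of facets of `P`. -/
abbrev Facet {n : ℕ} (P : Set (EuclideanSpace ℝ (Fin n))) : Type :=
  {F : Set (EuclideanSpace ℝ (Fin n)) // IsFacet P F}

/-- A simple `n`-polytope in `ℝⁿ`: every vertex lies in exactly `n` facets. -/
structure IsSimplePolytope {n : ℕ} (P : Set (EuclideanSpace ℝ (Fin n))) : Prop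
    extends IsPolytope P where
  encard_facets : ∀ v ∈ P.extremePoints ℝ, {F : Facet P | v ∈ F.1}.encard = n

/-- The compact torus `𝕋ʳ = (ℝ/ℤ)ʳ`. -/
abbrev Torus (r : ℕ) : Type := Fin r → UnitAddCircle

/-- The one-parameter subgroup `φ ↦ a φ` of `𝕋ʳ` given by an integer vector `a ∈ ℤʳ`. -/
def circleHom {r : ℕ} (a : Fin r → ℤ) : UnitAddCircle →+ Torus r where
  toFun φ := fun j => a j • φ
  map_zero' := by ext j; simp
  map_add' x y := by ext j; simp

/-- The subgroup `{∑_{F ∋ p} Λ_F φ_F : φ_F ∈ ℝ/ℤ}` of `𝕋ʳ`. (A polytope has finitely many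
facets, so that all families `φ` are finitely supported.) -/
def colorSubgroup {n r : ℕ} {P : Set (EuclideanSpace ℝ (Fin n))} (Λ : Facet P → Fin r → ℤ)
    (p : EuclideanSpace ℝ (Fin n)) : AddSubgroup (Torus r) where
  carrier := {t | ∃ φ : Facet P →₀ UnitAddCircle, (∀ F, φ F ≠ 0 → p ∈ F.1) ∧
    t = φ.sum fun F x => circleHom (Λ F) x}
  zero_mem' := ⟨0, by simp, by simp⟩
  add_mem' := by
    classical
    rintro _ _ ⟨φ, hφ, rfl⟩ ⟨ψ, hψ, rfl⟩
    refine ⟨φ + ψ, fun F hF => ?_, ?_⟩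
    · by_contra hp
      exact hF (by simp [not_imp_comm.1 (hφ F) hp, not_imp_comm.1 (hψ F) hp])
    · rw [Finsupp.sum_add_index' (by simp) (by simp)]
  neg_mem' := by
    rintro _ ⟨φ, hφ, rfl⟩
    refine ⟨-φ, fun F hF => hφ F (by simpa using hF), ?_⟩
    rw [Finsupp.sum_neg_index (by simp)]
    simp [Finsupp.sum]

/-- The relation on `P × 𝕋ʳ`: `(p₁, t₁) ∼ (p₂, t₂)` iff `p₁ = p₂` and
`t₁ - t₂ ∈ {∑_{F ∋ p₁} Λ_F φ_F}`. -/
def torusSetoid {n r : ℕ} {P : Set (EuclideanSpace ℝ (Fin n))} (Λ : Facet P → Fin r → ℤ) :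
    Setoid (P × Torus r) where
  r x y := x.1 = y.1 ∧ x.2 - y.2 ∈ colorSubgroup Λ x.1
  iseqv := by
    refine ⟨fun x => ⟨rfl, by simp⟩, fun {x y} h => ⟨h.1.symm, ?_⟩,
      fun {x y z} h h' => ⟨h.1.trans h'.1, ?_⟩⟩
    · rw [← h.1, ← neg_sub]
      exact neg_mem h.2
    · rw [← sub_add_sub_cancel x.2 y.2 z.2]
      exact add_mem h.2 (h.1 ▸ h'.2)

/-- The space `M(P, Λ) = P × 𝕋ʳ / ∼`. -/
def TorusSpace {n r : ℕ} {P : Set (EuclideanSpace ℝ (Fin n))} (Λ : Facet P → Fin r → ℤ) : Type :=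
  Quotient (torusSetoid Λ)

/-- `M(P, Λ)` carries the quotient topology. -/
instance {n r : ℕ} {P : Set (EuclideanSpace ℝ (Fin n))} (Λ : Facet P → Fin r → ℤ) :
    TopologicalSpace (TorusSpace Λ) :=
  inferInstanceAs (TopologicalSpace (Quotient (torusSetoid Λ)))

/-- A closed topological `d`-manifold: a compact, Hausdorff, second countable space every point of
which has an open neighbourhood homeomorphic to an open subset of `ℝᵈ` (so no boundary). -/
structure IsClosedTopologicalManifold (d : ℕ) (X : Type*) [TopologicalSpace X] : Prop where
  t2Space : T2Space X
  secondCountable : SecondCountableTopology X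
  compactSpace : CompactSpace X
  nonempty_chartedSpace : Nonempty (ChartedSpace (EuclideanSpace ℝ (Fin d)) X)

/-! Near a vertex `v`, a simple polytope looks like an orthant: the slacks of the `n` facets through
`v` are affine coordinates, identifying the open star of `v` (the points all of whose facets contain
`v`) with an open subset of `ℝ≥0ⁿ`. These stars cover `P`. A basis of `ℤʳ` containing the colours at
`v` gives an automorphism of the torus turning the collapsed subgroups into coordinate subtori, so
the local model is a product with one factor for each basis vector `j`.

The factor of `j` is an orthant `ℝ≥0^K`, with `K` the facets at `v` of colour `j`, times a circle
collapsed over the boundary of the orthant. Since several facets may share a colour, `K` can have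
any size. For nonempty `K` the orthant is `ℝ^(|K|-1) × [0,∞)`, the last coordinate being the
minimum, and collapsing the circle over `0 ∈ [0,∞)` produces `ℂ`; for empty `K` the factor is a
circle. Either way it is a manifold of dimension `|K| + 1`, and the dimensions add up to `n + r`.

The work is in `IsPolytope.exists_isFacetNormals` (exposed faces of codimension one are the
irredundant inequalities), `exists_isCollapse_boundaryRel` (the model factor) and
`TorusSpace.exists_chart` (descent to the quotients). -/

theorem exists_pos_forall_inner_add_lt {ι E : Type*} [Finite ι] [NormedAddCommGroup E]
    [InnerProductSpace ℝ E] (a : ι → E) (b : ι → ℝ) (x u : E) :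
    ∃ ε : ℝ, 0 < ε ∧ ∀ i, inner ℝ (a i) x < b i → inner ℝ (a i) x + ε * |inner ℝ (a i) u| < b i := by
  have h : ∀ᶠ ε : ℝ in nhdsWithin 0 (Set.Ioi 0), ∀ i, inner ℝ (a i) x < b i →
      inner ℝ (a i) x + ε * |inner ℝ (a i) u| < b i := by
    refine Filter.eventually_all.2 fun i => ?_
    by_cases hi : inner ℝ (a i) x < b i
    · have hc : Continuous fun ε : ℝ => inner ℝ (a i) x + ε * |inner ℝ (a i) u| := by fun_prop
      have := (hc.tendsto 0).eventually_lt_const (u := b i) (by simpa using hi)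
      filter_upwards [nhdsWithin_le_nhds this] with ε hε _ using hε
    · exact Filter.Eventually.of_forall fun _ h => absurd h hi
  obtain ⟨ε, h1, h2⟩ := (h.and self_mem_nhdsWithin).exists
  exact ⟨ε, h2, h1⟩

/-! ### Facets, irredundant inequalities and vertices of a polytope -/

section HalfSpaces

variable {n : ℕ} {P : Set (EuclideanSpace ℝ (Fin n))} {ι : Type*}
  {a : ι → EuclideanSpace ℝ (Fin n)} {b : ι → ℝ}

theorem inner_lt_of_mem_interior {c : EuclideanSpace ℝ (Fin n)} {d : ℝ} (hc : c ≠ 0)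
    (h : ∀ x ∈ P, inner ℝ c x ≤ d) {x : EuclideanSpace ℝ (Fin n)} (hx : x ∈ interior P) :
    inner ℝ c x < d := by
  have hcont : Continuous fun ε : ℝ => x + ε • c := by fun_prop
  have h1 : ∀ᶠ ε : ℝ in nhds 0, x + ε • c ∈ P :=
    hcont.continuousAt.eventually_mem (by simpa using mem_interior_iff_mem_nhds.1 hx)
  obtain ⟨ε, h1, h2⟩ := ((h1.filter_mono nhdsWithin_le_nhds).and
    (self_mem_nhdsWithin (s := Set.Ioi (0 : ℝ)))).exists
  have h3 := h _ h1
  rw [inner_add_right, inner_smul_right] at h3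
  have : 0 < ε * inner ℝ c c := mul_pos h2 (real_inner_self_pos.2 hc)
  linarith

theorem convex_setOf_forall_inner_le (hP : P = {x | ∀ i, inner ℝ (a i) x ≤ b i}) :
    Convex ℝ P := by
  rw [hP, Set.ofPred_forall]
  exact convex_iInter fun i => convex_halfSpace_le (innerSL ℝ (a i)).toLinearMap.isLinear _

theorem isClosed_setOf_forall_inner_le (hP : P = {x | ∀ i, inner ℝ (a i) x ≤ b i}) :
    IsClosed P := by
  rw [hP, Set.ofPred_forall]
  exact isClosed_iInter fun i => isClosed_le (by fun_prop) continuous_const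

theorem mem_interior_of_forall_inner_lt [Finite ι] (hP : P = {x | ∀ i, inner ℝ (a i) x ≤ b i})
    {x : EuclideanSpace ℝ (Fin n)} (hx : ∀ i, inner ℝ (a i) x < b i) : x ∈ interior P := by
  refine mem_interior.2 ⟨{x | ∀ i, inner ℝ (a i) x < b i}, ?_, ?_, hx⟩
  · rw [hP]
    exact fun y hy i => (hy i).le
  · rw [Set.ofPred_forall]
    exact isOpen_iInter_of_finite fun i => isOpen_lt (by fun_prop) continuous_const

theorem inner_eq_zero_of_mem_vectorSpan {F : Set (EuclideanSpace ℝ (Fin n))}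
    {c : EuclideanSpace ℝ (Fin n)} {d : ℝ} (h : ∀ x ∈ F, inner ℝ c x = d)
    {u : EuclideanSpace ℝ (Fin n)} (hu : u ∈ vectorSpan ℝ F) : inner ℝ c u = 0 := by
  have hle : vectorSpan ℝ F ≤ LinearMap.ker (innerSL ℝ c).toLinearMap := by
    refine Submodule.span_le.2 ?_
    rintro _ ⟨x, hx, y, hy, rfl⟩
    simp [inner_sub_right, h x hx, h y hy]
  simpa using hle hu

theorem finrank_orthogonal_singleton_add_one {c : EuclideanSpace ℝ (Fin n)} (hc : c ≠ 0) :
    Module.finrank ℝ (Submodule.span ℝ {c})ᗮ + 1 = n := by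
  have := (Submodule.span ℝ {c}).finrank_add_finrank_orthogonal
  rw [finrank_span_singleton hc, finrank_euclideanSpace_fin] at this
  omega

/-- A system of half-spaces cutting out `P`, none of which can be left out. -/
structure IsIrredundant (P : Set (EuclideanSpace ℝ (Fin n))) (a : ι → EuclideanSpace ℝ (Fin n))
    (b : ι → ℝ) : Prop where
  eq_setOf : P = {x | ∀ i, inner ℝ (a i) x ≤ b i}
  exists_lt : ∀ i, ∃ z, b i < inner ℝ (a i) z ∧ ∀ j, j ≠ i → inner ℝ (a j) z ≤ b j

/-- Take a minimal subfamily still cutting out `P`; an inequality without a witness `z` could be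
dropped. -/
theorem IsPolytope.exists_isIrredundant (hP : IsPolytope P) :
    ∃ (ι : Type) (_ : Finite ι) (a : ι → EuclideanSpace ℝ (Fin n)) (b : ι → ℝ),
      IsIrredundant P a b := by
  classical
  obtain ⟨k, a, b, hab⟩ := hP.exists_halfSpaces
  obtain ⟨S, hS⟩ := exists_minimal_of_wellFoundedLT
    (fun S : Finset (Fin k) => P = {x | ∀ i ∈ S, inner ℝ (a i) x ≤ b i})
    ⟨Finset.univ, by simpa using hab⟩
  refine ⟨S, inferInstance, fun i => a i, fun i => b i, by simpa using hS.prop, ?_⟩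
  rintro ⟨i, hi⟩
  by_contra! hcon
  have : P = {x | ∀ j ∈ S.erase i, inner ℝ (a j) x ≤ b j} := by
    refine subset_antisymm (fun x hx j hj => ?_) fun x hx => ?_
    · rw [hS.prop] at hx
      exact hx j (Finset.mem_of_mem_erase hj)
    · rw [hS.prop]
      intro j hj
      by_contra! hlt
      by_cases hji : j = i
      · subst hji
        obtain ⟨l, hl, hl'⟩ := hcon x hlt
        exact absurd (hx l (Finset.mem_erase.2 ⟨fun h => hl (Subtype.ext h), l.2⟩)) (not_le.2 hl')
      · exact absurd (hx j (Finset.mem_erase.2 ⟨hji, hj⟩)) (not_le.2 hlt)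
  exact (Finset.mem_erase.1 (hS.le_of_le this (Finset.erase_subset i S) hi)).1 rfl

theorem IsPolytope.interior_nonempty (hP : IsPolytope P) : (interior P).Nonempty := by
  obtain ⟨k, a, b, hab⟩ := hP.exists_halfSpaces
  exact (convex_setOf_forall_inner_le hab).interior_nonempty_iff_affineSpan_eq_top.2
    hP.affineSpan_eq_top

theorem IsIrredundant.ne_zero (h : IsIrredundant P a b) (hP : IsPolytope P) (i : ι) : a i ≠ 0 := by
  intro h0
  obtain ⟨x, hx⟩ := hP.interior_nonempty
  have hx := interior_subset hx
  rw [h.eq_setOf] at hx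
  obtain ⟨z, hz, -⟩ := h.exists_lt i
  have := hx i
  simp only [h0, inner_zero_left] at this hz
  linarith

/-- Join an interior point `y` to a point `z` violating only inequality `i`. The segment crosses
hyperplane `i` strictly between its ends, where the other inequalities, strict at `y` and weak at
`z`, remain strict. -/
theorem IsIrredundant.exists_eq_forall_lt (h : IsIrredundant P a b) (hP : IsPolytope P) (i : ι) :
    ∃ w ∈ P, inner ℝ (a i) w = b i ∧ ∀ j, j ≠ i → inner ℝ (a j) w < b j := by
  obtain ⟨y, hy⟩ := hP.interior_nonempty
  have hlt : ∀ j, inner ℝ (a j) y < b j := fun j =>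
    inner_lt_of_mem_interior (h.ne_zero hP j)
      (fun x hx => by rw [h.eq_setOf] at hx; exact hx j) hy
  obtain ⟨z, hz, hz'⟩ := h.exists_lt i
  have hy_i := hlt i
  set s := (b i - inner ℝ (a i) y) / (inner ℝ (a i) z - inner ℝ (a i) y) with hs
  have hpos : 0 < inner ℝ (a i) z - inner ℝ (a i) y := by linarith
  have hs0 : 0 < s := div_pos (by linarith) hpos
  have hs1 : s < 1 := (div_lt_one hpos).2 (by linarith)
  have hmul : s * (inner ℝ (a i) z - inner ℝ (a i) y) = b i - inner ℝ (a i) y :=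
    div_mul_cancel₀ _ hpos.ne'
  have hw : ∀ j, inner ℝ (a j) (y + s • (z - y)) =
      inner ℝ (a j) y + s * (inner ℝ (a j) z - inner ℝ (a j) y) := fun j => by
    rw [inner_add_right, inner_smul_right, inner_sub_right]
  have heq : inner ℝ (a i) (y + s • (z - y)) = b i := by rw [hw]; linarith
  have hlt' : ∀ j, j ≠ i → inner ℝ (a j) (y + s • (z - y)) < b j := fun j hj => by
    rw [hw]
    nlinarith [hz' j hj, hlt j, mul_nonneg hs0.le (sub_nonneg.2 (hz' j hj)),
      mul_pos (sub_pos.2 hs1) (sub_pos.2 (hlt j))]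
  refine ⟨_, ?_, heq, hlt'⟩
  rw [h.eq_setOf]
  intro j
  by_cases hj : j = i
  · exact hj ▸ heq.le
  · exact (hlt' j hj).le

/-- Around a point where only inequality `i` is tight, every small move orthogonal to `a i` stays in
the face, so the face spans the whole hyperplane direction. -/
theorem IsIrredundant.isFacet [Finite ι] (h : IsIrredundant P a b) (hP : IsPolytope P) (i : ι) :
    IsFacet P {x ∈ P | inner ℝ (a i) x = b i} := by
  obtain ⟨w, hwP, hw, hw'⟩ := h.exists_eq_forall_lt hP i
  refine ⟨⟨w, hwP, hw⟩, fun _ => ⟨innerSL ℝ (a i), ?_⟩, ?_⟩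
  · ext x
    refine and_congr_right fun hx => ⟨fun hx' y hy => ?_, fun hx' => ?_⟩
    · rw [h.eq_setOf] at hy
      simpa [hx'] using hy i
    · rw [h.eq_setOf] at hx
      exact le_antisymm (hx i) (by simpa [hw] using hx' w hwP)
  · suffices hspan : vectorSpan ℝ {x ∈ P | inner ℝ (a i) x = b i} = (Submodule.span ℝ {a i})ᗮ by
      rw [hspan, finrank_orthogonal_singleton_add_one (h.ne_zero hP i)]
    refine le_antisymm (fun u hu => ?_) fun u hu => ?_
    · rw [Submodule.mem_orthogonal_singleton_iff_inner_right]
      exact inner_eq_zero_of_mem_vectorSpan (fun x hx => hx.2) hu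
    · rw [Submodule.mem_orthogonal_singleton_iff_inner_right] at hu
      obtain ⟨ε, hε, hlt⟩ := exists_pos_forall_inner_add_lt a b w u
      have hi : inner ℝ (a i) (w + ε • u) = b i := by
        rw [inner_add_right, inner_smul_right, hu, hw, mul_zero, add_zero]
      have hmem : w + ε • u ∈ {x ∈ P | inner ℝ (a i) x = b i} := by
        refine ⟨?_, hi⟩
        rw [h.eq_setOf]
        intro j
        by_cases hj : j = i
        · exact hj ▸ hi.le
        · have := hlt j (hw' j hj)
          rw [inner_add_right, inner_smul_right]
          have := mul_le_mul_of_nonneg_left (le_abs_self (inner ℝ (a j) u)) hε.le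
          linarith
      have := vsub_mem_vectorSpan ℝ hmem (⟨hwP, hw⟩ : w ∈ {x ∈ P | inner ℝ (a i) x = b i})
      rw [vsub_eq_sub, add_sub_cancel_left] at this
      exact (Submodule.smul_mem_iff _ hε.ne').1 this

/-- Some inequality is tight on all of `F`: otherwise averaging gives a point of `F` interior to
`P`, where the exposing functional has a local maximum, hence vanishes, and `F = P` has the wrong
dimension. By dimension `F` then spans the direction of that hyperplane, so the functional is
constant on the hyperplane and `F` is its whole intersection with `P`. -/
theorem IsFacet.exists_eq_setOf [Finite ι] {F : Set (EuclideanSpace ℝ (Fin n))}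
    (hF : IsFacet P F) (hP : IsPolytope P) (h : IsIrredundant P a b) :
    ∃ i, F = {x ∈ P | inner ℝ (a i) x = b i} := by
  classical
  obtain ⟨l, hl⟩ := hF.isExposed hF.nonempty
  have hFP : F ⊆ P := hF.isExposed.subset
  have hconv : Convex ℝ F := hF.isExposed.convex (convex_setOf_forall_inner_le h.eq_setOf)
  have hle : ∀ x ∈ P, ∀ i, inner ℝ (a i) x ≤ b i := fun x hx => by
    rw [h.eq_setOf] at hx; exact hx
  obtain ⟨x₀, hx₀⟩ := hF.nonempty
  have hex : ∃ i, ∀ x ∈ F, inner ℝ (a i) x = b i := by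
    by_contra! hcon
    have hfin : ∀ s : Finset ι, ∃ x ∈ F, ∀ i ∈ s, inner ℝ (a i) x < b i := by
      intro s
      induction s using Finset.induction_on with
      | empty => exact ⟨x₀, hx₀, by simp⟩
      | insert i s his ih =>
        obtain ⟨x, hx, hxs⟩ := ih
        obtain ⟨y, hy, hyi⟩ := hcon i
        refine ⟨(1 / 2 : ℝ) • x + (1 / 2 : ℝ) • y,
          hconv hx hy (by norm_num) (by norm_num) (by norm_num), fun j hj => ?_⟩
        rw [inner_add_right, inner_smul_right, inner_smul_right]
        have h1 := hle x (hFP hx) j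
        have h2 := hle y (hFP hy) j
        rcases Finset.mem_insert.1 hj with rfl | hj
        · have := lt_of_le_of_ne h2 hyi
          linarith
        · have := hxs j hj
          linarith
    cases nonempty_fintype ι
    obtain ⟨x, hx, hxi⟩ := hfin Finset.univ
    have hint := mem_interior_of_forall_inner_lt h.eq_setOf fun i => hxi i (Finset.mem_univ i)
    have hmax : IsLocalMax l x := by
      rw [hl] at hx
      filter_upwards [mem_interior_iff_mem_nhds.1 hint] with y hy using hx.2 y hy
    have hl0 : l = 0 := hmax.hasFDerivAt_eq_zero l.hasFDerivAt
    have hFeq : F = P := by rw [hl, hl0]; simp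
    have hrank := hF.finrank_add_one
    rw [hFeq, ← direction_affineSpan, hP.affineSpan_eq_top, AffineSubspace.direction_top,
      finrank_top, finrank_euclideanSpace_fin] at hrank
    omega
  obtain ⟨i, hi⟩ := hex
  refine ⟨i, subset_antisymm (fun x hx => ⟨hFP hx, hi x hx⟩) fun x hx => ?_⟩
  have hspan : vectorSpan ℝ F = (Submodule.span ℝ {a i})ᗮ := by
    refine Submodule.eq_of_le_of_finrank_eq (fun u hu => ?_) ?_
    · rw [Submodule.mem_orthogonal_singleton_iff_inner_right]
      exact inner_eq_zero_of_mem_vectorSpan hi hu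
    · have h1 := hF.finrank_add_one
      have h2 := finrank_orthogonal_singleton_add_one (h.ne_zero hP i)
      omega
  have hker : vectorSpan ℝ F ≤ LinearMap.ker l.toLinearMap := by
    refine Submodule.span_le.2 ?_
    rintro _ ⟨x, hx, y, hy, rfl⟩
    rw [hl] at hx hy
    have := le_antisymm (hx.2 y hy.1) (hy.2 x hx.1)
    simp [this]
  have hxu : x - x₀ ∈ vectorSpan ℝ F := by
    rw [hspan, Submodule.mem_orthogonal_singleton_iff_inner_right, inner_sub_right, hx.2,
      hi x₀ hx₀, sub_self]
  have hlx : l x = l x₀ := by simpa [sub_eq_zero] using hker hxu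
  rw [hl] at hx₀ ⊢
  exact ⟨hx.1, fun y hy => hlx ▸ hx₀.2 y hy⟩

/-- Outer normals of the facets of a polytope: the polytope is cut out by the half-spaces of its
facets. -/
structure IsFacetNormals (P : Set (EuclideanSpace ℝ (Fin n)))
    (α : Facet P → EuclideanSpace ℝ (Fin n)) (β : Facet P → ℝ) : Prop where
  mem_iff : ∀ x, x ∈ P ↔ ∀ F, inner ℝ (α F) x ≤ β F
  mem_facet_iff : ∀ (F : Facet P) (x), x ∈ F.1 ↔ x ∈ P ∧ inner ℝ (α F) x = β F

theorem IsPolytope.exists_isFacetNormals (hP : IsPolytope P) :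
    Finite (Facet P) ∧ ∃ α β, IsFacetNormals P α β := by
  obtain ⟨ι, _, a, b, h⟩ := hP.exists_isIrredundant
  choose i hi using fun F : Facet P => F.2.exists_eq_setOf hP h
  refine ⟨Finite.of_injective i fun F G hFG => Subtype.ext ?_,
    fun F => a (i F), fun F => b (i F), fun x => ⟨fun hx F => ?_, fun hx => ?_⟩, fun F x => ?_⟩
  · rw [hi F, hi G, hFG]
  · rw [h.eq_setOf] at hx
    exact hx _
  · rw [h.eq_setOf]
    intro j
    obtain ⟨w, hwP, hw, hw'⟩ := h.exists_eq_forall_lt hP j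
    -- The point `w` is tight for `j` only, so no other inequality can define this facet.
    have heq : i ⟨_, h.isFacet hP j⟩ = j := by
      by_contra hne
      have hmem : w ∈ (⟨_, h.isFacet hP j⟩ : Facet P).1 := ⟨hwP, hw⟩
      rw [hi ⟨_, h.isFacet hP j⟩] at hmem
      exact (hw' _ hne).ne hmem.2
    simpa [heq] using hx ⟨_, h.isFacet hP j⟩
  · conv_lhs => rw [hi F]
    rfl

variable {α : Facet P → EuclideanSpace ℝ (Fin n)} {β : Facet P → ℝ}

/-- Otherwise `v` would be the midpoint of `v + ε • u` and `v - ε • u`, both in `P`. In effect, the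
facet normals at a vertex span the space. -/
theorem IsFacetNormals.eq_zero_of_mem_extremePoints [Finite (Facet P)] (h : IsFacetNormals P α β)
    {v u : EuclideanSpace ℝ (Fin n)} (hv : v ∈ P.extremePoints ℝ)
    (hu : ∀ F : Facet P, v ∈ F.1 → inner ℝ (α F) u = 0) : u = 0 := by
  obtain ⟨ε, hε, hlt⟩ := exists_pos_forall_inner_add_lt α β v u
  have hmem : ∀ c : ℝ, |c| = ε → v + c • u ∈ P := fun c hc => by
    rw [h.mem_iff]
    intro F
    rw [inner_add_right, inner_smul_right]
    by_cases hF : v ∈ F.1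
    · rw [hu F hF, mul_zero, add_zero]
      exact (h.mem_iff v).1 hv.1 F
    · have h1 := hlt F (lt_of_le_of_ne ((h.mem_iff v).1 hv.1 F)
        fun heq => hF ((h.mem_facet_iff F v).2 ⟨hv.1, heq⟩))
      have h2 := le_abs_self (c * inner ℝ (α F) u)
      rw [abs_mul, hc] at h2
      linarith
  have hv' := hv.2 (hmem ε (abs_of_pos hε)) (hmem (-ε) (by rw [abs_neg, abs_of_pos hε]))
    ⟨1 / 2, 1 / 2, by norm_num, by norm_num, by norm_num, by module⟩
  have : ε • u = 0 := by simpa using hv'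
  exact (smul_eq_zero.1 this).resolve_left hε.ne'

/-- The intersection of `P` with the facets through `p` is a compact extreme subset, so it has an
extreme point, which is a vertex of `P`. This makes the stars of the vertices cover `P`. -/
theorem IsFacetNormals.exists_mem_extremePoints (h : IsFacetNormals P α β) (hP : IsPolytope P)
    {p : EuclideanSpace ℝ (Fin n)} (hp : p ∈ P) :
    ∃ v ∈ P.extremePoints ℝ, ∀ F : Facet P, p ∈ F.1 → v ∈ F.1 := by
  have hPeq : P = {x | ∀ F, inner ℝ (α F) x ≤ β F} := Set.ext h.mem_iff
  set G : Set (EuclideanSpace ℝ (Fin n)) := {x ∈ P | ∀ F : Facet P, p ∈ F.1 → x ∈ F.1} with hG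
  have hGext : IsExtreme ℝ P G := by
    refine ⟨fun x hx => hx.1, fun x hx y hy z hz hxyz => ?_⟩
    refine ⟨hx, fun F hF => ?_⟩
    have hz' := ((h.mem_facet_iff F z).1 (hz.2 F hF)).2
    obtain ⟨s, t, hs, ht, hst, rfl⟩ := hxyz
    rw [inner_add_right, inner_smul_right, inner_smul_right] at hz'
    have h1 := (h.mem_iff x).1 hx F
    have h2 := (h.mem_iff y).1 hy F
    refine (h.mem_facet_iff F x).2 ⟨hx, le_antisymm h1 ?_⟩
    by_contra! hlt
    have h3 := mul_lt_mul_of_pos_left hlt hs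
    have h4 := mul_le_mul_of_nonneg_left h2 ht.le
    have h5 : s * β F + t * β F = β F := by rw [← add_mul, hst, one_mul]
    linarith
  have hGclosed : IsClosed G := by
    have : G = P ∩ ⋂ (F : Facet P) (_ : p ∈ F.1), {x | inner ℝ (α F) x = β F} := by
      ext x
      simp only [hG, Set.mem_ofPred_eq, Set.mem_inter_iff, Set.mem_iInter]
      exact and_congr_right fun hx => forall₂_congr fun F _ => by simp [h.mem_facet_iff, hx]
    rw [this]
    exact (isClosed_setOf_forall_inner_le hPeq).inter (isClosed_iInter fun F =>
      isClosed_iInter fun _ => isClosed_eq (by fun_prop) continuous_const)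
  have hGcompact : IsCompact G :=
    Metric.isCompact_of_isClosed_isBounded hGclosed (hP.isBounded.subset fun x hx => hx.1)
  obtain ⟨v, hv⟩ := hGcompact.extremePoints_nonempty ⟨p, hp, fun _ h => h⟩
  exact ⟨v, hGext.extremePoints_subset_extremePoints hv, hv.1.2⟩

end HalfSpaces

open scoped NNReal

/-- Every point of `Y` lies in the domain of a chart with values in `ℝᵈ`. -/
def IsLocallyEuclidean (d : ℕ) (Y : Type*) [TopologicalSpace Y] : Prop :=
  ∀ y : Y, ∃ e : OpenPartialHomeomorph Y (EuclideanSpace ℝ (Fin d)), y ∈ e.source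

/-! ### Locally Euclidean spaces -/

section LocallyEuclidean

variable {d : ℕ} {Y : Type*} [TopologicalSpace Y]

theorem isLocallyEuclidean_of_forall_exists {E : Type*} [NormedAddCommGroup E] [NormedSpace ℝ E]
    [FiniteDimensional ℝ E] (hE : Module.finrank ℝ E = d)
    (h : ∀ y : Y, ∃ e : OpenPartialHomeomorph Y E, y ∈ e.source) : IsLocallyEuclidean d Y := by
  intro y
  obtain ⟨e, he⟩ := h y
  have f : E ≃L[ℝ] EuclideanSpace ℝ (Fin d) :=
    ContinuousLinearEquiv.ofFinrankEq (by rw [hE, finrank_euclideanSpace_fin])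
  exact ⟨e.transHomeomorph f.toHomeomorph, he⟩

theorem IsLocallyEuclidean.pi {ι : Type*} [Fintype ι] {d : ι → ℕ} {Y : ι → Type*}
    [∀ i, TopologicalSpace (Y i)] (h : ∀ i, IsLocallyEuclidean (d i) (Y i)) :
    IsLocallyEuclidean (∑ i, d i) (∀ i, Y i) := by
  refine isLocallyEuclidean_of_forall_exists (E := ∀ i, EuclideanSpace ℝ (Fin (d i)))
    (by simp [Module.finrank_pi_fintype]) fun y => ?_
  choose e he using fun i => h i (y i)
  exact ⟨OpenPartialHomeomorph.pi e, fun i _ => he i⟩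

theorem isLocallyEuclidean_unitAddCircle : IsLocallyEuclidean 1 UnitAddCircle := by
  refine isLocallyEuclidean_of_forall_exists (E := ℝ) (Module.finrank_self ℝ) fun y => ?_
  obtain ⟨x, rfl⟩ := QuotientAddGroup.mk_surjective y
  refine ⟨(AddCircle.openPartialHomeomorphCoe (1 : ℝ) (x - 1 / 2)).symm, ?_⟩
  have hx : x ∈ (AddCircle.openPartialHomeomorphCoe (1 : ℝ) (x - 1 / 2)).source := by
    constructor <;> linarith
  exact (AddCircle.openPartialHomeomorphCoe (1 : ℝ) (x - 1 / 2)).map_source hx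

end LocallyEuclidean

/-! ### The local model: circles collapsed over the boundary of an orthant -/

section Collapse

/-- `G : A × T → Y` is a continuous surjection over `A`, identifying `(a, t)` with `(a, t')`
exactly when `R a t t'`. -/
structure IsCollapse {A T Y : Type*} [TopologicalSpace A] [TopologicalSpace T] [TopologicalSpace Y]
    (R : A → T → T → Prop) (G : A × T → Y) (ρ : Y → A) : Prop where
  continuous : Continuous G
  continuous_proj : Continuous ρ
  surjective : Function.Surjective G
  proj_apply : ∀ x, ρ (G x) = x.1
  eq_iff : ∀ a t t', G (a, t) = G (a, t') ↔ R a t t'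

variable {A T Y : Type*} [TopologicalSpace A] [TopologicalSpace T] [TopologicalSpace Y]
  {R : A → T → T → Prop} {G : A × T → Y} {ρ : Y → A}

theorem IsCollapse.apply_eq_apply_iff (h : IsCollapse R G ρ) {a a' : A} {t t' : T} :
    G (a, t) = G (a', t') ↔ a = a' ∧ R a t t' := by
  constructor
  · intro heq
    obtain rfl : a = a' := by simpa [h.proj_apply] using congrArg ρ heq
    exact ⟨rfl, (h.eq_iff _ _ _).1 heq⟩
  · rintro ⟨rfl, hR⟩
    exact (h.eq_iff _ _ _).2 hR

/-- The graph-like map `(a, t) ↦ (G (a, t), t)` is a closed embedding, with left inverse given by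
`ρ`, and projecting away the compact `T` is closed; so `G` is a closed map. -/
theorem IsCollapse.isQuotientMap [CompactSpace T] [T2Space T] [T2Space Y] (h : IsCollapse R G ρ) :
    Topology.IsQuotientMap G := by
  have hemb : Topology.IsClosedEmbedding fun x : A × T => (G x, x.2) :=
    Function.LeftInverse.isClosedEmbedding (f := fun y : Y × T => (ρ y.1, y.2))
      (fun x => by simp [h.proj_apply]) (by have := h.continuous_proj; fun_prop)
      (by have := h.continuous; fun_prop)
  have hcl : IsClosedMap G := isClosedMap_fst_of_compactSpace.comp hemb.isClosedMap
  exact hcl.isQuotientMap h.continuous h.surjective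

/-- The relation collapsing the circle over the boundary of the orthant. -/
def BoundaryRel {K : Type*} (a : K → ℝ≥0) (t t' : UnitAddCircle) : Prop :=
  t = t' ∨ ∃ k, a k = 0

theorem exists_toCircle_smul_eq (z : ℂ) :
    ∃ t : UnitAddCircle, (‖z‖ : ℂ) * (AddCircle.toCircle t : ℂ) = z := by
  refine ⟨((Complex.arg z / (2 * Real.pi) : ℝ) : UnitAddCircle), ?_⟩
  rw [AddCircle.toCircle_apply_mk, div_one, mul_div_cancel₀ _ (by positivity), Circle.coe_exp,
    Complex.norm_mul_exp_arg_mul_I]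

theorem exists_isCollapse_boundaryRel (K : Type) [Fintype K] :
    ∃ (Y : Type) (_ : TopologicalSpace Y) (G : (K → ℝ≥0) × UnitAddCircle → Y) (ρ : Y → K → ℝ≥0),
      T2Space Y ∧ IsLocallyEuclidean (Fintype.card K + 1) Y ∧ IsCollapse BoundaryRel G ρ := by
  classical
  rcases isEmpty_or_nonempty K with hK | ⟨⟨k₀⟩⟩
  -- The orthant is a point without boundary, so nothing is collapsed.
  · refine ⟨UnitAddCircle, inferInstance, Prod.snd, fun _ => 0, inferInstance, ?_, ?_⟩
    · simpa using isLocallyEuclidean_unitAddCircle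
    · exact ⟨continuous_snd, continuous_const, fun t => ⟨(0, t), rfl⟩,
        fun _ => Subsingleton.elim _ _, fun _ _ _ => by simp [BoundaryRel]⟩
  · have hne : (Finset.univ : Finset K).Nonempty := ⟨k₀, Finset.mem_univ k₀⟩
    let m : (K → ℝ) → ℝ := fun x => Finset.univ.inf' hne x
    have hm_cont : Continuous m :=
      Continuous.finset_inf'_apply hne fun k _ => continuous_apply k
    have hm_le : ∀ x k, m x ≤ x k := fun x k => Finset.inf'_le _ (Finset.mem_univ k)
    have hm_ex : ∀ x, ∃ k, m x = x k := fun x => by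
      obtain ⟨k, -, hk⟩ := Finset.exists_mem_eq_inf' hne x
      exact ⟨k, hk⟩
    have hm_add : ∀ (x : K → ℝ) (c : ℝ), m (fun k => x k + c) = m x + c := fun x c => by
      obtain ⟨k, hk⟩ := hm_ex x
      obtain ⟨l, hl⟩ := hm_ex fun k => x k + c
      have h1 := hm_le x l
      have h2 : m (fun k => x k + c) ≤ x k + c := hm_le _ k
      have h3 : m (fun k => x k + c) = x l + c := hl
      linarith
    have hm_nonneg : ∀ a : K → ℝ≥0, 0 ≤ m fun k => a k := fun a => by
      obtain ⟨k, hk⟩ := hm_ex fun k => a k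
      exact hk ▸ (a k).2
    have hm_zero : ∀ a : K → ℝ≥0, (m fun k => a k) = 0 ↔ ∃ k, a k = 0 := fun a => by
      constructor
      · intro h
        obtain ⟨k, hk⟩ := hm_ex fun k => a k
        exact ⟨k, by exact_mod_cast hk.symm.trans h⟩
      · rintro ⟨k, hk⟩
        refine le_antisymm ?_ (hm_nonneg a)
        simpa [hk] using hm_le (fun k => a k) k
    -- Differences to coordinate `k₀` and the minimum determine a point of the orthant. `ext`
    -- restores coordinate `k₀` as `0`; `ρ` then shifts all coordinates equally so that the minimum
    -- becomes `‖y.2‖`.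
    let ext : ({k // k ≠ k₀} → ℝ) → K → ℝ := fun y k => if h : k = k₀ then 0 else y ⟨k, h⟩
    have hext : Continuous ext := by
      refine continuous_pi fun k => ?_
      by_cases h : k = k₀
      · simp only [ext, h, dite_true]; exact continuous_const
      · simp only [ext, h, dite_false]; exact continuous_apply _
    let G : (K → ℝ≥0) × UnitAddCircle → ({k // k ≠ k₀} → ℝ) × ℂ := fun x =>
      (fun k => x.1 k - x.1 k₀, ((m fun k => x.1 k : ℝ) : ℂ) * (AddCircle.toCircle x.2 : ℂ))
    let ρ : ({k // k ≠ k₀} → ℝ) × ℂ → K → ℝ≥0 := fun y k =>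
      (ext y.1 k + (‖y.2‖ - m (ext y.1))).toNNReal
    have hρ : ∀ y k, (ρ y k : ℝ) = ext y.1 k + (‖y.2‖ - m (ext y.1)) := fun y k =>
      Real.coe_toNNReal _ (by linarith [hm_le (ext y.1) k, norm_nonneg y.2])
    have hmρ : ∀ y, (m fun k => ρ y k) = ‖y.2‖ := fun y => by
      simp only [hρ, hm_add]
      ring
    refine ⟨({k // k ≠ k₀} → ℝ) × ℂ, inferInstance, G, ρ, inferInstance, ?_, ?_⟩
    · refine isLocallyEuclidean_of_forall_exists (E := ({k // k ≠ k₀} → ℝ) × ℂ) ?_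
        fun y => ⟨(Homeomorph.refl _).toOpenPartialHomeomorph, trivial⟩
      have : 0 < Fintype.card K := Fintype.card_pos_iff.2 ⟨k₀⟩
      simp
      omega
    · refine ⟨?_, ?_, fun y => ?_, fun x => ?_, fun a t t' => ?_⟩
      · have h1 : Continuous fun x : (K → ℝ≥0) × UnitAddCircle => m fun k => x.1 k :=
          hm_cont.comp (by fun_prop)
        have h2 : Continuous fun x : (K → ℝ≥0) × UnitAddCircle => (AddCircle.toCircle x.2 : ℂ) :=
          by fun_prop
        exact Continuous.prodMk (by fun_prop) ((Complex.continuous_ofReal.comp h1).mul h2)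
      · refine continuous_pi fun k => continuous_real_toNNReal.comp ?_
        have h1 : Continuous fun y : ({k // k ≠ k₀} → ℝ) × ℂ => ext y.1 := hext.comp continuous_fst
        exact ((continuous_apply k).comp h1).add (continuous_snd.norm.sub (hm_cont.comp h1))
      · obtain ⟨t, ht⟩ := exists_toCircle_smul_eq y.2
        refine ⟨(ρ y, t), Prod.ext (funext fun k => ?_) ?_⟩
        · have h1 : ext y.1 k = y.1 k := by simp [ext, k.2]
          have h2 : ext y.1 k₀ = 0 := by simp [ext]
          simp only [G, hρ, h1, h2]
          ring
        · simp only [G, hmρ, ht]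
      · have h1 : ext (G x).1 = fun k => (x.1 k : ℝ) + -(x.1 k₀ : ℝ) := by
          funext k
          by_cases h : k = k₀
          · simp [ext, h]
          · simp [ext, h, G, sub_eq_add_neg]
        have h2 : ‖(G x).2‖ = m fun k => x.1 k := by
          simp [G, abs_of_nonneg (hm_nonneg x.1), Circle.norm_coe]
        funext k
        refine NNReal.coe_injective ?_
        rw [hρ, h2, h1, hm_add]
        ring
      · have hinj := AddCircle.injective_toCircle (T := (1 : ℝ)) one_ne_zero
        simp only [G, Prod.mk.injEq, true_and, mul_eq_mul_left_iff, Complex.ofReal_eq_zero,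
          hm_zero, BoundaryRel, Circle.coe_inj, hinj.eq_iff]

/-- Coordinates of the orthant are grouped by the circle they collapse, and the model is the product
of the factors over all circles, including those with no coordinates. -/
theorem exists_isCollapse_pi {ι κ : Type} [Fintype ι] [Fintype κ] (c : ι → κ) :
    ∃ (Y : Type) (_ : TopologicalSpace Y) (G : (ι → ℝ≥0) × (κ → UnitAddCircle) → Y)
      (ρ : Y → ι → ℝ≥0),
      T2Space Y ∧ IsLocallyEuclidean (Fintype.card ι + Fintype.card κ) Y ∧
        IsCollapse (fun a t t' => ∀ j, t j = t' j ∨ ∃ i, c i = j ∧ a i = 0) G ρ := by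
  classical
  choose Y topY G ρ hT2 hEuc hG using fun j => exists_isCollapse_boundaryRel {i // c i = j}
  refine ⟨∀ j, Y j, inferInstance, fun x j => G j (fun i => x.1 i, x.2 j),
    fun y i => ρ (c i) (y (c i)) ⟨i, rfl⟩, inferInstance, ?_, ?_⟩
  · have hcard : ∑ j, (Fintype.card {i // c i = j} + 1) = Fintype.card ι + Fintype.card κ := by
      rw [Finset.sum_add_distrib, ← Fintype.card_sigma,
        Fintype.card_congr (Equiv.sigmaFiberEquiv c)]
      simp
    exact hcard ▸ IsLocallyEuclidean.pi hEuc
  · refine ⟨?_, ?_, fun y => ?_, fun x => ?_, fun a t t' => ?_⟩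
    · exact continuous_pi fun j => (hG j).continuous.comp (by fun_prop)
    · exact continuous_pi fun i => (continuous_apply _).comp
        ((hG (c i)).continuous_proj.comp (continuous_apply _))
    · choose x hx using fun j => (hG j).surjective (y j)
      refine ⟨(fun i => ρ (c i) (y (c i)) ⟨i, rfl⟩, fun j => (x j).2), funext fun j => ?_⟩
      have : (fun i : {i // c i = j} => ρ (c i) (y (c i)) ⟨i, rfl⟩) = (x j).1 := by
        rw [← (hG j).proj_apply, hx]
        funext ⟨i, hi⟩
        subst hi
        rfl
      simp only [this]
      exact hx j
    · funext i
      simp [(hG _).proj_apply]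
    · simp only [funext_iff, (hG _).eq_iff, BoundaryRel, Subtype.exists, exists_prop]

end Collapse

/-- A partial homeomorphism between the sources of two quotient maps that matches their fibres
descends to the targets. -/
theorem Topology.IsQuotientMap.exists_openPartialHomeomorph {X M Z Y : Type*} [TopologicalSpace X]
    [TopologicalSpace M] [TopologicalSpace Z] [TopologicalSpace Y] {q : X → M} {Q : Z → Y}
    (hq : Topology.IsQuotientMap q) (hQ : Topology.IsQuotientMap Q)
    (h : OpenPartialHomeomorph X Z) {V : Set M} {W : Set Y} (hV : h.source = q ⁻¹' V)
    (hW : h.target = Q ⁻¹' W)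
    (hfib : ∀ x ∈ h.source, ∀ x' ∈ h.source, q x = q x' ↔ Q (h x) = Q (h x')) :
    ∃ e : OpenPartialHomeomorph M Y, e.source = V := by
  have hVo : IsOpen V := hq.isOpen_preimage.1 (hV ▸ h.open_source)
  have hWo : IsOpen W := hQ.isOpen_preimage.1 (hW ▸ h.open_target)
  -- The chosen preimages are arbitrary: matching of fibres makes `f` and `g` independent of them on
  -- `V` and `W`.
  let f : M → Y := fun m => Q (h (Function.surjInv hq.surjective m))
  let g : Y → M := fun y => q (h.symm (Function.surjInv hQ.surjective y))
  have hf : ∀ x ∈ h.source, f (q x) = Q (h x) := fun x hx => by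
    have hx' := Function.surjInv_eq hq.surjective (q x)
    refine (hfib _ ?_ x hx).1 hx'
    rw [hV] at hx ⊢
    simpa [hx'] using hx
  have hg : ∀ z ∈ h.target, g (Q z) = q (h.symm z) := fun z hz => by
    have hz' := Function.surjInv_eq hQ.surjective (Q z)
    have hmem : Function.surjInv hQ.surjective (Q z) ∈ h.target := by
      rw [hW] at hz ⊢
      simpa [hz'] using hz
    refine (hfib _ (h.map_target hmem) _ (h.map_target hz)).2 ?_
    rw [h.right_inv hmem, h.right_inv hz, hz']
  have hV' : ∀ m ∈ V, ∃ x ∈ h.source, q x = m := fun m hm => by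
    obtain ⟨x, rfl⟩ := hq.surjective m
    exact ⟨x, hV ▸ hm, rfl⟩
  have hW' : ∀ y ∈ W, ∃ z ∈ h.target, Q z = y := fun y hy => by
    obtain ⟨z, rfl⟩ := hQ.surjective y
    exact ⟨z, hW ▸ hy, rfl⟩
  have hQmem : ∀ z ∈ h.target, Q z ∈ W := fun z hz => by rw [hW] at hz; exact hz
  have hqmem : ∀ x ∈ h.source, q x ∈ V := fun x hx => by rw [hV] at hx; exact hx
  refine ⟨{ toFun := f, invFun := g, source := V, target := W, map_source' := ?_,
            map_target' := ?_, left_inv' := ?_, right_inv' := ?_, open_source := hVo,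
            open_target := hWo, continuousOn_toFun := ?_, continuousOn_invFun := ?_ }, rfl⟩
  · intro m hm
    obtain ⟨x, hx, rfl⟩ := hV' m hm
    rw [hf x hx]
    exact hQmem _ (h.map_source hx)
  · intro y hy
    obtain ⟨z, hz, rfl⟩ := hW' y hy
    rw [hg z hz]
    exact hqmem _ (h.map_target hz)
  · intro m hm
    obtain ⟨x, hx, rfl⟩ := hV' m hm
    rw [hf x hx, hg _ (h.map_source hx), h.left_inv hx]
  · intro y hy
    obtain ⟨z, hz, rfl⟩ := hW' y hy
    rw [hg z hz, hf _ (h.map_target hz), h.right_inv hz]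
  · refine (hq.continuousOn_isOpen_iff hVo).2 ?_
    rw [← hV]
    exact (hQ.continuous.comp_continuousOn h.continuousOn).congr hf
  · refine (hQ.continuousOn_isOpen_iff hWo).2 ?_
    rw [← hW]
    exact (hq.continuous.comp_continuousOn h.continuousOn_symm).congr hg

/-! ### Integer bases and coordinate subtori -/

section TorusEquiv

/-- The endomorphism of the torus given by an integer matrix. -/
def torusHom {r : ℕ} (A : Matrix (Fin r) (Fin r) ℤ) : Torus r →+ Torus r where
  toFun t i := ∑ j, A i j • t j
  map_zero' := by ext i; simp
  map_add' s t := by ext i; simp [Finset.sum_add_distrib]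

theorem torusHom_mul {r : ℕ} (A B : Matrix (Fin r) (Fin r) ℤ) (t : Torus r) :
    torusHom (A * B) t = torusHom A (torusHom B t) := by
  funext i
  simp only [torusHom, AddMonoidHom.coe_mk, ZeroHom.coe_mk, Matrix.mul_apply, Finset.sum_smul,
    Finset.smul_sum, mul_smul]
  exact Finset.sum_comm

theorem torusHom_one {r : ℕ} (t : Torus r) :
    torusHom (1 : Matrix (Fin r) (Fin r) ℤ) t = t := by
  funext i
  simp [torusHom, Matrix.one_apply, ite_smul]

theorem continuous_torusHom {r : ℕ} (A : Matrix (Fin r) (Fin r) ℤ) : Continuous (torusHom A) :=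
  continuous_pi fun i => continuous_finsetSum Finset.univ fun j _ =>
    (continuous_apply (A := fun _ => UnitAddCircle) j).zsmul (A i j)

/-- The automorphism of the torus given by a basis of `ℤʳ`. -/
noncomputable def torusEquiv {r : ℕ} (b : Module.Basis (Fin r) ℤ (Fin r → ℤ)) :
    Torus r ≃ₜ+ Torus r where
  __ := torusHom ((Pi.basisFun ℤ (Fin r)).toMatrix b)
  invFun := torusHom (b.toMatrix (Pi.basisFun ℤ (Fin r)))
  left_inv t := by
    change torusHom _ (torusHom _ t) = t
    rw [← torusHom_mul, Module.Basis.toMatrix_mul_toMatrix_flip, torusHom_one]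
  right_inv t := by
    change torusHom _ (torusHom _ t) = t
    rw [← torusHom_mul, Module.Basis.toMatrix_mul_toMatrix_flip, torusHom_one]
  continuous_toFun := continuous_torusHom _
  continuous_invFun := continuous_torusHom _

theorem torusEquiv_single {r : ℕ} (b : Module.Basis (Fin r) ℤ (Fin r → ℤ)) (j : Fin r)
    (x : UnitAddCircle) : torusEquiv b (Pi.single j x) = circleHom (b j) x := by
  change torusHom _ _ = _
  funext i
  rw [torusHom, AddMonoidHom.coe_mk, ZeroHom.coe_mk, Finset.sum_eq_single j]
  · simp [circleHom, Module.Basis.toMatrix_apply]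
  · intro k _ hk
    simp [Pi.single_eq_of_ne hk]
  · simp

theorem circleHom_mem_colorSubgroup {n r : ℕ} {P : Set (EuclideanSpace ℝ (Fin n))}
    (Λ : Facet P → Fin r → ℤ) {p : EuclideanSpace ℝ (Fin n)} {F : Facet P} (hF : p ∈ F.1)
    (x : UnitAddCircle) : circleHom (Λ F) x ∈ colorSubgroup Λ p := by
  classical
  refine ⟨Finsupp.single F x, fun G hG => ?_, ?_⟩
  · rw [Finsupp.single_apply_ne_zero] at hG
    exact hG.1 ▸ hF
  · exact (Finsupp.sum_single_index (h := fun F x => circleHom (Λ F) x) (map_zero _)).symm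

/-- In the basis `b` each facet through `p` contributes the coordinate circle of its colour, so the
subgroup becomes the subtorus of the colours occurring at `p`. Facets sharing a colour contribute
the same circle. -/
theorem torusEquiv_mem_colorSubgroup_iff {n r : ℕ} {P : Set (EuclideanSpace ℝ (Fin n))}
    {Λ : Facet P → Fin r → ℤ} {b : Module.Basis (Fin r) ℤ (Fin r → ℤ)}
    {p v : EuclideanSpace ℝ (Fin n)} {c : {F : Facet P // v ∈ F.1} → Fin r}
    (hc : ∀ F, Λ F.1 = b (c F)) (hpv : ∀ F : Facet P, p ∈ F.1 → v ∈ F.1) {s : Torus r} :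
    torusEquiv b s ∈ colorSubgroup Λ p ↔
      ∀ j, s j = 0 ∨ ∃ F : {F : Facet P // v ∈ F.1}, c F = j ∧ p ∈ F.1.1 := by
  classical
  constructor
  · rintro ⟨φ, hφ, hs⟩ j
    by_contra! hcon
    refine hcon.1 ?_
    have hs' : s = φ.sum fun F x => (torusEquiv b).symm (circleHom (Λ F) x) := by
      rw [← map_finsuppSum, ← hs, ContinuousAddEquiv.symm_apply_apply]
    rw [hs', Finsupp.sum, Finset.sum_apply]
    refine Finset.sum_eq_zero fun F hF => ?_
    have hpF := hφ F (Finsupp.mem_support_iff.1 hF)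
    rw [hc ⟨F, hpv F hpF⟩, ← torusEquiv_single, ContinuousAddEquiv.symm_apply_apply]
    exact Pi.single_eq_of_ne (fun h => hcon.2 ⟨F, hpv F hpF⟩ h.symm hpF) _
  · intro h
    rw [← Finset.univ_sum_single s, map_sum]
    refine sum_mem fun j _ => ?_
    rw [torusEquiv_single]
    rcases h j with hj | ⟨F, rfl, hF⟩
    · rw [hj, map_zero]
      exact zero_mem _
    · rw [← hc]
      exact circleHom_mem_colorSubgroup Λ hF _

end TorusEquiv

/-! ### Charts of the polytope and of the quotient around a vertex -/

section Charts

variable {n r : ℕ} {P : Set (EuclideanSpace ℝ (Fin n))}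
  {α : Facet P → EuclideanSpace ℝ (Fin n)} {β : Facet P → ℝ} {v : EuclideanSpace ℝ (Fin n)}

theorem IsSimplePolytope.card_facets (hP : IsSimplePolytope P) (hv : v ∈ P.extremePoints ℝ)
    [Fintype {F : Facet P // v ∈ F.1}] : Fintype.card {F : Facet P // v ∈ F.1} = n := by
  have h := hP.encard_facets v hv
  have hcard : {F : Facet P | v ∈ F.1}.encard = Fintype.card {F : Facet P // v ∈ F.1} :=
    ENat.card_eq_coe_fintype_card (α := {F : Facet P // v ∈ F.1})
  exact_mod_cast hcard.symm.trans h

/-- Simplicity makes the linear part a map between spaces of equal dimension `n`; it is injective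
because the normals at a vertex have no common kernel. -/
theorem IsFacetNormals.exists_homeomorph [Finite (Facet P)] (h : IsFacetNormals P α β)
    (hP : IsSimplePolytope P) (hv : v ∈ P.extremePoints ℝ) :
    ∃ L : EuclideanSpace ℝ (Fin n) ≃ₜ ({F : Facet P // v ∈ F.1} → ℝ),
      ∀ x F, L x F = β F.1 - inner ℝ (α F.1) x := by
  cases nonempty_fintype {F : Facet P // v ∈ F.1}
  let f : EuclideanSpace ℝ (Fin n) →ₗ[ℝ] ({F : Facet P // v ∈ F.1} → ℝ) :=
    LinearMap.pi fun F => (innerSL ℝ (α F.1)).toLinearMap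
  have hf : Function.Injective f := by
    refine (injective_iff_map_eq_zero f).2 fun u hu =>
      h.eq_zero_of_mem_extremePoints hv fun F hF => ?_
    simpa [f] using congrFun hu ⟨F, hF⟩
  let e := (LinearEquiv.ofInjectiveOfFinrankEq f hf
    (by simp [hP.card_facets hv])).toContinuousLinearEquiv
  refine ⟨e.toHomeomorph.trans (Homeomorph.subLeft fun F => β F.1), fun x F => rfl⟩

theorem IsFacetNormals.exists_openPartialHomeomorph [Finite (Facet P)] (h : IsFacetNormals P α β)
    (hP : IsSimplePolytope P) (hv : v ∈ P.extremePoints ℝ) :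
    ∃ e : OpenPartialHomeomorph P ({F : Facet P // v ∈ F.1} → ℝ≥0),
      e.source = {p | ∀ F : Facet P, p.1 ∈ F.1 → v ∈ F.1} ∧
        ∀ p F, e p F = 0 ↔ p.1 ∈ F.1.1 := by
  classical
  obtain ⟨L, hL⟩ := h.exists_homeomorph hP hv
  have hL' : ∀ y F, inner ℝ (α F.1) (L.symm y) = β F.1 - y F := fun y F => by
    have := hL (L.symm y) F
    rw [L.apply_symm_apply] at this
    linarith
  let σ : ({F : Facet P // v ∈ F.1} → ℝ≥0) → EuclideanSpace ℝ (Fin n) :=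
    fun y => L.symm fun F => y F
  have hσ : Continuous σ := L.symm.continuous.comp (by fun_prop)
  let τ : P → {F : Facet P // v ∈ F.1} → ℝ≥0 := fun p F => (L p F).toNNReal
  have hτ : Continuous τ := continuous_pi fun F => continuous_real_toNNReal.comp
    ((continuous_apply F).comp (L.continuous.comp continuous_subtype_val))
  have hτ' : ∀ p F, (τ p F : ℝ) = L p F := fun p F =>
    Real.coe_toNNReal _ (by rw [hL]; linarith [(h.mem_iff p).1 p.2 F.1])
  have hστ : ∀ p, σ (τ p) = p := fun p => by simp only [σ, hτ', L.symm_apply_apply]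
  -- Nonnegative slacks take care of the facets at `v`; strictness of the remaining inequalities is
  -- an open condition and, on `P`, says that no other facet is met.
  let D : Set ({F : Facet P // v ∈ F.1} → ℝ≥0) :=
    {y | ∀ F : Facet P, v ∉ F.1 → inner ℝ (α F) (σ y) < β F}
  let U : Set P := {p | ∀ F : Facet P, v ∉ F.1 → inner ℝ (α F) p.1 < β F}
  have hU : U = {p | ∀ F : Facet P, p.1 ∈ F.1 → v ∈ F.1} := by
    ext p
    refine forall_congr' fun F => ?_
    rw [← not_imp_not (a := v ∈ F.1), h.mem_facet_iff F p]
    refine imp_congr_right fun _ => ⟨fun hlt hF => hlt.ne hF.2, fun hne => ?_⟩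
    exact lt_of_le_of_ne ((h.mem_iff p).1 p.2 F) fun heq => hne ⟨p.2, heq⟩
  have hDP : ∀ y ∈ D, σ y ∈ P := fun y hy => by
    rw [h.mem_iff]
    intro F
    by_cases hF : v ∈ F.1
    · rw [hL' _ ⟨F, hF⟩]
      linarith [(y ⟨F, hF⟩).2]
    · exact (hy F hF).le
  -- The value `v` is a dummy: `σ y` lies in `P` for all `y ∈ D`.
  let g : ({F : Facet P // v ∈ F.1} → ℝ≥0) → P := fun y =>
    if hy : σ y ∈ P then ⟨σ y, hy⟩ else ⟨v, hv.1⟩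
  have hg : ∀ y ∈ D, (g y : EuclideanSpace ℝ (Fin n)) = σ y := fun y hy => by
    simp only [g, dif_pos (hDP y hy)]
  refine ⟨{ toFun := τ, invFun := g, source := U, target := D, map_source' := ?_,
            map_target' := ?_, left_inv' := ?_, right_inv' := ?_, open_source := ?_,
            open_target := ?_, continuousOn_toFun := hτ.continuousOn,
            continuousOn_invFun := ?_ }, hU, fun p F => ?_⟩
  · intro p hp F hF
    rw [hστ]
    exact hp F hF
  · intro y hy F hF
    rw [hg y hy]
    exact hy F hF
  · intro p hp
    refine Subtype.ext ?_
    rw [hg, hστ]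
    intro F hF
    rw [hστ]
    exact hp F hF
  · intro y hy
    funext F
    refine NNReal.coe_injective ?_
    rw [hτ', hg y hy, L.apply_symm_apply]
  · rw [Topology.IsInducing.subtypeVal.continuousOn_iff]
    exact hσ.continuousOn.congr hg
  · rw [show U = ⋂ (F : Facet P) (_ : v ∉ F.1), {p | inner ℝ (α F) p.1 < β F} by ext; simp [U]]
    exact isOpen_iInter_of_finite fun F => isOpen_iInter_of_finite fun _ =>
      isOpen_lt (by fun_prop) continuous_const
  · rw [show D = ⋂ (F : Facet P) (_ : v ∉ F.1), {y | inner ℝ (α F) (σ y) < β F} by ext; simp [D]]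
    exact isOpen_iInter_of_finite fun F => isOpen_iInter_of_finite fun _ =>
      isOpen_lt (by fun_prop) continuous_const
  · change τ p F = 0 ↔ _
    rw [← NNReal.coe_eq_zero, hτ', hL, h.mem_facet_iff, sub_eq_zero, eq_comm]
    simp [p.2]

variable {Λ : Facet P → Fin r → ℤ}

/-- The projection `M(P, Λ) → P`. -/
def TorusSpace.proj (Λ : Facet P → Fin r → ℤ) : TorusSpace Λ → P :=
  Quotient.lift Prod.fst fun _ _ h => h.1

theorem TorusSpace.continuous_proj : Continuous (TorusSpace.proj Λ) :=
  Continuous.quotient_lift continuous_fst _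

theorem TorusSpace.isQuotientMap_mk :
    Topology.IsQuotientMap (fun x => Quotient.mk (torusSetoid Λ) x : P × Torus r → TorusSpace Λ) :=
  isQuotientMap_quot_mk

/-- The slack chart times the inverse torus automorphism carries `∼` to the relation of the model: a
slack vanishes exactly on its facet, which is exactly when its colour circle is collapsed. -/
theorem TorusSpace.exists_chart [Finite (Facet P)] (h : IsFacetNormals P α β)
    (hP : IsSimplePolytope P) (hv : v ∈ P.extremePoints ℝ)
    (hbasis : ∃ b : Module.Basis (Fin r) ℤ (Fin r → ℤ),
      Λ '' {F : Facet P | v ∈ F.1} ⊆ Set.range b) :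
    ∃ (Y : Type) (_ : TopologicalSpace Y) (e : OpenPartialHomeomorph (TorusSpace Λ) Y),
      T2Space Y ∧ IsLocallyEuclidean (n + r) Y ∧
        e.source = {m | ∀ F : Facet P, (TorusSpace.proj Λ m).1 ∈ F.1 → v ∈ F.1} := by
  cases nonempty_fintype {F : Facet P // v ∈ F.1}
  obtain ⟨b, hb⟩ := hbasis
  choose c hc using fun F : {F : Facet P // v ∈ F.1} => hb ⟨F.1, F.2, rfl⟩
  obtain ⟨e, he, he0⟩ := h.exists_openPartialHomeomorph hP hv
  obtain ⟨Y, _, G, ρ, hT2, hEuc, hG⟩ := exists_isCollapse_pi c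
  rw [hP.card_facets hv, Fintype.card_fin] at hEuc
  have hquot : ∃ f : OpenPartialHomeomorph (TorusSpace Λ) Y,
      f.source = {m | ∀ F : Facet P, (TorusSpace.proj Λ m).1 ∈ F.1 → v ∈ F.1} := by
    refine TorusSpace.isQuotientMap_mk.exists_openPartialHomeomorph hG.isQuotientMap
      (e.prod (torusEquiv b).symm.toHomeomorph.toOpenPartialHomeomorph) (W := ρ ⁻¹' e.target)
      (by rw [OpenPartialHomeomorph.prod_source, he]; exact Set.prod_univ)
      (by ext x; simp [hG.proj_apply]) ?_
    rintro ⟨p, t⟩ hp ⟨p', t'⟩ hp'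
    have hp : p ∈ e.source := hp.1
    have hp' : p' ∈ e.source := hp'.1
    have hpv : ∀ F : Facet P, p.1 ∈ F.1 → v ∈ F.1 := by rw [he] at hp; exact hp
    refine Quotient.eq.trans (Iff.trans ?_ hG.apply_eq_apply_iff.symm)
    refine and_congr (e.injOn.eq_iff hp hp').symm ?_
    have ht : t - t' = torusEquiv b ((torusEquiv b).symm t - (torusEquiv b).symm t') := by
      simp
    change t - t' ∈ colorSubgroup Λ p.1 ↔ _
    rw [ht, torusEquiv_mem_colorSubgroup_iff (fun F => (hc F).symm) hpv]
    refine forall_congr' fun j => or_congr sub_eq_zero (exists_congr fun F => ?_)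
    exact and_congr_right fun _ => (he0 p F).symm
  obtain ⟨f, hf⟩ := hquot
  exact ⟨Y, inferInstance, f, hT2, hEuc, hf⟩

end Charts

theorem mainTheorem11 {n r : ℕ} (P : Set (EuclideanSpace ℝ (Fin n))) (hP : IsSimplePolytope P)
    (Λ : Facet P → Fin r → ℤ) (hne : ∀ F, Λ F ≠ 0)
    (hspan : Submodule.span ℤ (Set.range Λ) = ⊤)
    (hbasis : ∀ v ∈ P.extremePoints ℝ, ∃ b : Module.Basis (Fin r) ℤ (Fin r → ℤ),
      Λ '' {F : Facet P | v ∈ F.1} ⊆ Set.range b) :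
    IsClosedTopologicalManifold (n + r) (TorusSpace Λ) := by
  obtain ⟨_, α, β, h⟩ := hP.toIsPolytope.exists_isFacetNormals
  have hchart : ∀ p : P, ∃ (Y : Type) (_ : TopologicalSpace Y)
      (e : OpenPartialHomeomorph (TorusSpace Λ) Y), T2Space Y ∧ IsLocallyEuclidean (n + r) Y ∧
        ∀ m, TorusSpace.proj Λ m = p → m ∈ e.source := fun p => by
    obtain ⟨v, hv, hpv⟩ := h.exists_mem_extremePoints hP.toIsPolytope p.2
    obtain ⟨Y, _, e, hT2, hEuc, he⟩ := TorusSpace.exists_chart h hP hv (hbasis v hv)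
    exact ⟨Y, inferInstance, e, hT2, hEuc, fun m hm => by rw [he]; subst hm; exact hpv⟩
  have hcompactP : IsCompact P := Metric.isCompact_of_isClosed_isBounded
    (isClosed_setOf_forall_inner_le (Set.ext h.mem_iff)) hP.isBounded
  have : CompactSpace P := isCompact_iff_compactSpace.1 hcompactP
  have hcompact : CompactSpace (TorusSpace Λ) :=
    inferInstanceAs (CompactSpace (Quotient (torusSetoid Λ)))
  have hEuc : IsLocallyEuclidean (n + r) (TorusSpace Λ) := fun m => by
    obtain ⟨Y, _, e, -, hEuc, he⟩ := hchart (TorusSpace.proj Λ m)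
    obtain ⟨f, hf⟩ := hEuc (e m)
    exact ⟨e.trans f, by simpa using ⟨he m rfl, hf⟩⟩
  choose e he using hEuc
  let charted : ChartedSpace (EuclideanSpace ℝ (Fin (n + r))) (TorusSpace Λ) :=
    { atlas := Set.range e, chartAt := e, mem_chart_source := he,
      chart_mem_atlas := fun x => ⟨x, rfl⟩ }
  refine ⟨⟨fun x y hxy => ?_⟩, ?_, hcompact, ⟨charted⟩⟩
  · by_cases hp : TorusSpace.proj Λ x = TorusSpace.proj Λ y
    -- A chart domain contains whole fibres over `P`, so two points of one fibre are separated in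
    -- the Hausdorff model `Y`; points of different fibres are separated in `P`.
    · obtain ⟨Y, _, f, _, -, hf⟩ := hchart (TorusSpace.proj Λ x)
      have hx := hf x rfl
      have hy := hf y hp.symm
      obtain ⟨u, w, hu, hw, hxu, hyw, huw⟩ := t2_separation fun heq => hxy (f.injOn hx hy heq)
      refine ⟨_, _, f.isOpen_inter_preimage hu, f.isOpen_inter_preimage hw, ⟨hx, hxu⟩, ⟨hy, hyw⟩,
        (huw.preimage f).mono Set.inter_subset_right Set.inter_subset_right⟩
    · exact separated_by_continuous TorusSpace.continuous_proj hp
  · exact ChartedSpace.secondCountable_of_sigmaCompact (EuclideanSpace ℝ (Fin (n + r))) _
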